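/- For a finite set $V$ and an integer $r\ge 2$, an $r$-uniform graph $G$ on $V$ is given by a set $E(G)$ of $r$-element subsets of $V=V(G)$; its density is $d(G)=|E(G)|/\binom{|V(G)|}{r}$, and a subgraph of $G$ is an $r$-uniform graph $H$ with $V(H)\subseteq V(G)$ and $E(H)\subseteq E(G)$. A real number $\alpha\in[0,1)$ is a jump for $r$ if there is a constant $c>0$ such that for every $\epsilon>0$ and every integer $m\ge r$ there is an integer $n_0=n_0(\epsilon,m)$ such that every $r$-uniform graph with $n>n_0$ vertices and density at least $\alpha+\epsilon$ contains a subgraph with $m$ vertices and density at least $\alpha+c$. A number $\alpha\in[0,1)$ that is not a jump for $r$ is called a non-jump for $r$. Corollary. For every integer $r\ge 3$, the number $\dfrac{54\,r!}{25\,r^r}$ lies in $[0,1)$ and is a non-jump for $r$. Moreover $\dfrac{54\,r!}{25\,r^r}<\dfrac{5\,r!}{2\,r^r}$. -/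

import Mathlib

open scoped Nat

namespace HypergraphJump

/-- `G` is an `r`-uniform graph: its vertex set is finite, and each edge is an `r`-element set
(that edges are sets of vertices of `G` is part of Mathlib's `Hypergraph`). For `r = 0` the
condition `Set.ncard e = 0` still means `e = ∅`, since `e` lies in the finite vertex set. -/
structure IsUniformGraph {V : Type*} (r : ℕ) (G : Hypergraph V) : Prop where
  finite_vertexSet : G.vertexSet.Finite
  ncard_edge : ∀ e ∈ G.edgeSet, e.ncard = r

/-- The density `|E(G)| / (|V(G)| choose r)` of an `r`-uniform graph `G`. -/
noncomputable def density {V : Type*} (r : ℕ) (G : Hypergraph V) : ℝ :=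
  (G.edgeSet.ncard : ℝ) / (G.vertexSet.ncard.choose r : ℝ)

/-- `H` is a (not necessarily induced) subgraph of `G`. -/
def IsSubgraph {V : Type*} (H G : Hypergraph V) : Prop :=
  H.vertexSet ⊆ G.vertexSet ∧ H.edgeSet ⊆ G.edgeSet

/-- The defining property of a jump `α` for `r`: there is a constant `c > 0` such that for any
`ε > 0` and any integer `m ≥ r` there is `n₀` such that any `r`-uniform graph with `n > n₀` vertices
and density at least `α + ε` contains a subgraph with `m` vertices and density at least `α + c`. -/
def JumpProperty (r : ℕ) (α : ℝ) : Prop :=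
  ∃ c : ℝ, 0 < c ∧ ∀ ε : ℝ, 0 < ε → ∀ m : ℕ, r ≤ m → ∃ n₀ : ℕ,
    ∀ (V : Type) (G : Hypergraph V), IsUniformGraph r G → n₀ < G.vertexSet.ncard →
      α + ε ≤ density r G →
        ∃ H : Hypergraph V, IsSubgraph H G ∧ H.vertexSet.ncard = m ∧ α + c ≤ density r H

/-- A real number `α ∈ [0, 1)` is a jump for an integer `r ≥ 2` if it has the jump property. -/
def IsJump (r : ℕ) (α : ℝ) : Prop :=
  2 ≤ r ∧ α ∈ Set.Ico (0 : ℝ) 1 ∧ JumpProperty r α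

/-- A real number `α ∈ [0, 1)` is a non-jump for an integer `r ≥ 2` if it is not a jump for `r`. -/
def IsNonJump (r : ℕ) (α : ℝ) : Prop :=
  2 ≤ r ∧ α ∈ Set.Ico (0 : ℝ) 1 ∧ ¬ IsJump r α

end HypergraphJump

/-! Write α for the number in question. Take parts of relative sizes 2:2:1 and all triples of types
112, 123, 223; the polynomial of this pattern has maximum 2/25. Cut the first part into 3n equal
clusters, drop from type 112 the pairs inside a cluster, and add the transversal triples of a system
`A` on the clusters. With 5n² triples in `A` the gain outweighs the loss, so the density exceeds α
by a margin depending only on r and n, however large the clusters are (`le_density_blowupGraph`).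

Locally the gain is invisible. Random deletion yields `A` such that every set S of 2 to m clusters
spans at most |S| - 2 triples (`exists_locally_sparse_triples`). Among m vertices, with x and y of
them in the first two parts and p, q in the two largest clusters, the added triples number at most
pq(x-p-q) (`sum_prod_le_of_sparse`), while the dropped pairs cost at least y(p²+q²)/2. By
`perturbed_pattern_le` the total stays below 2/25 times the cube of the number of vertices in the
three parts.

For r = k + 3 every edge also takes one vertex from each of k further parts, and AM-GM
(`cube_mul_prod_le`) turns 2/25 into 27 · 2/25 = 54/25. So m-vertex subgraphs have density at most α
times a factor tending to 1 as m grows, and no c > 0 can work. -/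

namespace HypergraphJump

/-! ### Locally sparse triple systems by random deletion -/

/-- The triple of vertices determined by an index `i = (a, b, d)` and a function `w`. -/
def tripleEdge {n : ℕ} (w : Fin n × Fin n × Fin 6 → Fin n) (i : Fin n × Fin n × Fin 6) :
    Finset (Fin 3 × Fin n) :=
  {(0, i.1), (1, i.2.1), (2, w i)}

/-- The indices whose first two vertices lie in `S`. -/
def indicesOver {n : ℕ} (S : Finset (Fin 3 × Fin n)) : Finset (Fin n × Fin n × Fin 6) :=
  Finset.univ.filter fun i => (0, i.1) ∈ S ∧ (1, i.2.1) ∈ S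

/-- Pairs `(S, I)` with `2 ≤ |S| ≤ m` and `I` a set of `|S| - 1` indices over `S`. -/
def violations (n m : ℕ) :
    Finset (Σ _ : Finset (Fin 3 × Fin n), Finset (Fin n × Fin n × Fin 6)) :=
  ((Finset.Icc 2 m).biUnion fun v => Finset.univ.powersetCard v).sigma
    fun S => (indicesOver S).powersetCard (S.card - 1)

theorem card_tripleEdge {n : ℕ} (w : Fin n × Fin n × Fin 6 → Fin n) (i) :
    (tripleEdge w i).card = 3 := by
  unfold tripleEdge
  rw [Finset.card_eq_three]
  exact ⟨_, _, _, by simp, by simp, by simp, rfl⟩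

theorem tripleEdge_subset_iff {n : ℕ} (w : Fin n × Fin n × Fin 6 → Fin n) (i)
    (S : Finset (Fin 3 × Fin n)) :
    tripleEdge w i ⊆ S ↔ i ∈ indicesOver S ∧ (2, w i) ∈ S := by
  simp [tripleEdge, indicesOver, Finset.insert_subset_iff, and_assoc]

theorem card_indicesOver_le {n : ℕ} (S : Finset (Fin 3 × Fin n)) :
    (indicesOver S).card ≤ 6 * S.card ^ 2 := by
  have : (indicesOver S).card ≤ (S ×ˢ S ×ˢ (Finset.univ : Finset (Fin 6))).card := by
    refine Finset.card_le_card_of_injOn (fun i => ((0, i.1), (1, i.2.1), i.2.2)) ?_ ?_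
    · intro i hi
      simpa [indicesOver] using hi
    · rintro ⟨a, b, d⟩ _ ⟨a', b', d'⟩ _ h
      simpa using h
  refine this.trans (le_of_eq ?_)
  simp only [Finset.card_product, Finset.card_univ, Fintype.card_fin]
  ring

/-- The values of a uniformly random `w` are independent, so all of `I` lands in `T` with
probability (|T|/|β|)^|I|. Denominators are cleared to stay in ℕ. -/
theorem card_filter_forall_mem_mul_le {ι β : Type*} [Fintype ι] [DecidableEq ι] [Fintype β]
    [DecidableEq β] (I : Finset ι) (T : Finset β) :
    (Finset.univ.filter fun w : ι → β => ∀ i ∈ I, w i ∈ T).card * Fintype.card β ^ I.card =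
      T.card ^ I.card * Fintype.card β ^ Fintype.card ι := by
  have h : (Finset.univ.filter fun w : ι → β => ∀ i ∈ I, w i ∈ T) =
      Fintype.piFinset fun i => if i ∈ I then T else Finset.univ := by
    ext w
    simp only [Finset.mem_filter, Finset.mem_univ, true_and, Fintype.mem_piFinset]
    refine forall_congr' fun i => ?_
    by_cases hi : i ∈ I <;> simp [hi]
  rw [h, Fintype.card_piFinset]
  simp_rw [apply_ite Finset.card]
  rw [Finset.prod_ite, Finset.prod_const, Finset.prod_const, Finset.card_univ]
  have h1 : (Finset.univ.filter (· ∈ I)) = I := by ext; simp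
  have h2 : (Finset.univ.filter (· ∉ I)) = Iᶜ := by ext; simp
  rw [h1, h2, mul_assoc, ← pow_add, Finset.card_compl_add_card]

/-- A constant bounding the expected number of violations. -/
def violationBound (m : ℕ) : ℕ :=
  ∑ v ∈ Finset.Icc 2 m, 3 ^ v * (2 ^ (6 * v ^ 2) * v ^ (v - 1))

theorem card_violating_mul_le {n : ℕ} (S : Finset (Fin 3 × Fin n))
    (I : Finset (Fin n × Fin n × Fin 6)) :
    (Finset.univ.filter fun w : Fin n × Fin n × Fin 6 → Fin n => ∀ i ∈ I, (2, w i) ∈ S).card *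
      n ^ I.card ≤ S.card ^ I.card * n ^ Fintype.card (Fin n × Fin n × Fin 6) := by
  have h := card_filter_forall_mem_mul_le I (Finset.univ.filter fun c : Fin n => (2, c) ∈ S)
  simp only [Finset.mem_filter, Finset.mem_univ, true_and] at h
  rw [Fintype.card_fin] at h
  rw [h]
  gcongr
  refine Finset.card_le_card_of_injOn (fun c => (2, c)) ?_ ?_
  · intro c hc; simpa using hc
  · intro c _ d _ hcd; simpa using hcd

/-- There are at most (3n)^v sets of size v, each with boundedly many index sets over it, each
violated with probability at most (v/n)^(v-1). The expected number of violations is thus O(n),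
against 6n² indices. -/
theorem sum_card_violating_le {n : ℕ} (hn : 0 < n) (m : ℕ) :
    ∑ p ∈ violations n m,
      (Finset.univ.filter fun w : Fin n × Fin n × Fin 6 → Fin n => ∀ i ∈ p.2, (2, w i) ∈ p.1).card ≤
      violationBound m * n * n ^ Fintype.card (Fin n × Fin n × Fin 6) := by
  set N := Fintype.card (Fin n × Fin n × Fin 6)
  unfold violations violationBound
  rw [Finset.sum_sigma, Finset.sum_biUnion, Finset.sum_mul, Finset.sum_mul]
  · refine Finset.sum_le_sum fun v hv => ?_
    have hv2 := (Finset.mem_Icc.1 hv).1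
    have hS : ∀ S ∈ (Finset.univ : Finset (Fin 3 × Fin n)).powersetCard v,
        (∑ I ∈ (indicesOver S).powersetCard (S.card - 1), (Finset.univ.filter
          fun w : Fin n × Fin n × Fin 6 → Fin n => ∀ i ∈ I, (2, w i) ∈ S).card) * n ^ (v - 1) ≤
        2 ^ (6 * v ^ 2) * (v ^ (v - 1) * n ^ N) := by
      intro S hS
      have hc : S.card = v := (Finset.mem_powersetCard.1 hS).2
      rw [Finset.sum_mul]
      calc _ ≤ ∑ I ∈ (indicesOver S).powersetCard (S.card - 1), v ^ (v - 1) * n ^ N := by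
            refine Finset.sum_le_sum fun I hI => ?_
            have hI' : I.card = v - 1 := by rw [(Finset.mem_powersetCard.1 hI).2, hc]
            have := card_violating_mul_le S I
            rwa [hI', hc] at this
        _ ≤ _ := by
            rw [Finset.sum_const, smul_eq_mul]
            refine Nat.mul_le_mul_right _ ?_
            calc _ ≤ (indicesOver S).powerset.card :=
                  Finset.card_le_card fun _ h =>
                    Finset.mem_powerset.2 (Finset.mem_powersetCard.1 h).1
              _ = 2 ^ (indicesOver S).card := Finset.card_powerset _
              _ ≤ _ := by
                refine Nat.pow_le_pow_right (by norm_num) ?_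
                rw [← hc]; exact card_indicesOver_le S
    refine Nat.le_of_mul_le_mul_right ?_ (pow_pos hn (v - 1))
    rw [Finset.sum_mul]
    refine (Finset.sum_le_sum hS).trans ?_
    rw [Finset.sum_const, smul_eq_mul, Finset.card_powersetCard, Finset.card_univ]
    have h3 : (Fintype.card (Fin 3 × Fin n)).choose v ≤ 3 ^ v * n ^ v := by
      refine (Nat.choose_le_pow _ _).trans ?_
      simp [mul_pow]
    calc _ ≤ 3 ^ v * n ^ v * (2 ^ (6 * v ^ 2) * (v ^ (v - 1) * n ^ N)) :=
          Nat.mul_le_mul_right _ h3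
      _ = _ := by
        have : n ^ v = n * n ^ (v - 1) := by rw [← pow_succ']; congr 1; omega
        rw [this]; ring
  · intro a _ b _ hab
    rw [Function.onFun, Finset.disjoint_left]
    intro S h1 h2
    exact hab ((Finset.mem_powersetCard.1 h1).2.symm.trans (Finset.mem_powersetCard.1 h2).2)

theorem exists_few_violated {n : ℕ} (hn : 0 < n) (m : ℕ) :
    ∃ w : Fin n × Fin n × Fin 6 → Fin n,
      ((violations n m).filter fun p => ∀ i ∈ p.2, (2, w i) ∈ p.1).card ≤
        violationBound m * n := by
  have : Nonempty (Fin n) := ⟨⟨0, hn⟩⟩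
  have h := sum_card_violating_le hn m
  simp_rw [Finset.card_filter] at h
  rw [Finset.sum_comm] at h
  simp_rw [← Finset.card_filter] at h
  have h2 : ∑ _w : Fin n × Fin n × Fin 6 → Fin n, violationBound m * n =
      violationBound m * n * n ^ Fintype.card (Fin n × Fin n × Fin 6) := by
    rw [Finset.sum_const, Finset.card_univ, smul_eq_mul, Fintype.card_fun, Fintype.card_fin,
      mul_comm]
  rw [← h2] at h
  obtain ⟨w, -, hw⟩ := Finset.exists_le_of_sum_le Finset.univ_nonempty h
  exact ⟨w, hw⟩

theorem exists_locally_sparse_triples (m : ℕ) (hm : 3 ≤ m) :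
    ∃ n : ℕ, 0 < n ∧ ∃ A : Finset (Finset (Fin 3 × Fin n)), (∀ e ∈ A, e.card = 3) ∧
      5 * n ^ 2 ≤ A.card ∧
      ∀ S, 2 ≤ S.card → S.card ≤ m → (A.filter (· ⊆ S)).card + 2 ≤ S.card := by
  obtain ⟨K, n, hn, hKn, w, hw⟩ : ∃ K n : ℕ, 0 < n ∧ K ≤ n ∧
      ∃ w : Fin n × Fin n × Fin 6 → Fin n,
        ((violations n m).filter fun p => ∀ i ∈ p.2, (2, w i) ∈ p.1).card ≤ K * n :=
    -- Taking n > K gives K n ≤ n², so at least 6n² - n² = 5n² indices survive the deletion of one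
    -- index per violation.
    ⟨violationBound m, violationBound m + 1, Nat.succ_pos _, Nat.le_succ _,
      exists_few_violated (Nat.succ_pos _) m⟩
  set B := (violations n m).filter fun p => ∀ i ∈ p.2, (2, w i) ∈ p.1 with hB
  have hne : ∀ p ∈ B, ∃ i, i ∈ p.2 := by
    intro p hp
    obtain ⟨h1, h2⟩ := Finset.mem_sigma.1 (Finset.mem_filter.1 hp).1
    obtain ⟨v, hv, hpv⟩ := Finset.mem_biUnion.1 h1
    have h3 := (Finset.mem_powersetCard.1 hpv).2
    have h4 := (Finset.mem_powersetCard.1 h2).2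
    have := (Finset.mem_Icc.1 hv).1
    exact Finset.card_pos.1 (by omega)
  have : Nonempty (Fin n × Fin n × Fin 6) := ⟨(⟨0, hn⟩, ⟨0, hn⟩, 0)⟩
  choose! g hg using hne
  set J := Finset.univ \ B.image g with hJ
  have hJcard : 6 * n ^ 2 ≤ J.card + K * n := by
    have h1 : (B.image g).card ≤ K * n := Finset.card_image_le.trans hw
    have h2 := Finset.le_card_sdiff (B.image g) (Finset.univ : Finset (Fin n × Fin n × Fin 6))
    rw [← hJ, Finset.card_univ, Fintype.card_prod, Fintype.card_prod, Fintype.card_fin,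
      Fintype.card_fin] at h2
    have : n * (n * 6) = 6 * n ^ 2 := by ring
    omega
  have hsparse : ∀ S : Finset (Fin 3 × Fin n), 2 ≤ S.card → S.card ≤ m →
      (J.filter fun i => tripleEdge w i ⊆ S).card + 2 ≤ S.card := by
    intro S h2 hSm
    by_contra hcon
    obtain ⟨I, hIsub, hIcard⟩ := Finset.exists_subset_card_eq
      (show S.card - 1 ≤ (J.filter fun i => tripleEdge w i ⊆ S).card by omega)
    have hI : ∀ i ∈ I, i ∈ J ∧ i ∈ indicesOver S ∧ (2, w i) ∈ S := fun i hi => by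
      have := Finset.mem_filter.1 (hIsub hi)
      exact ⟨this.1, (tripleEdge_subset_iff w i S).1 this.2⟩
    have hmem : (⟨S, I⟩ : Σ _ : Finset (Fin 3 × Fin n), Finset (Fin n × Fin n × Fin 6)) ∈ B := by
      refine Finset.mem_filter.2 ⟨Finset.mem_sigma.2 ⟨?_, ?_⟩, fun i hi => (hI i hi).2.2⟩
      · exact Finset.mem_biUnion.2 ⟨S.card, Finset.mem_Icc.2 ⟨h2, hSm⟩,
          Finset.mem_powersetCard.2 ⟨Finset.subset_univ _, rfl⟩⟩
      · exact Finset.mem_powersetCard.2 ⟨fun i hi => (hI i hi).2.1, hIcard⟩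
    have h3 := (hI _ (hg _ hmem)).1
    exact (Finset.mem_sdiff.1 h3).2 (Finset.mem_image_of_mem g hmem)
  -- Sparsity applied to the three vertices of a single triple, allowed since 3 ≤ m, leaves room for
  -- only one index there.
  have hinj : Set.InjOn (tripleEdge w) J := by
    intro i hi j hj hij
    by_contra hne
    have h := hsparse (tripleEdge w i) (by rw [card_tripleEdge]; omega)
      (by rw [card_tripleEdge]; omega)
    rw [card_tripleEdge] at h
    have h2 : ({i, j} : Finset _) ⊆ J.filter fun l => tripleEdge w l ⊆ tripleEdge w i := by
      intro l hl
      simp only [Finset.mem_insert, Finset.mem_singleton] at hl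
      rcases hl with rfl | rfl
      · exact Finset.mem_filter.2 ⟨hi, le_rfl⟩
      · exact Finset.mem_filter.2 ⟨hj, hij.ge⟩
    have h3 := Finset.card_le_card h2
    rw [Finset.card_pair hne] at h3
    omega
  refine ⟨n, hn, J.image (tripleEdge w), ?_, ?_, ?_⟩
  · intro e he
    obtain ⟨i, _, rfl⟩ := Finset.mem_image.1 he
    exact card_tripleEdge w i
  · rw [Finset.card_image_of_injOn hinj]
    have : K * n ≤ n ^ 2 := by rw [sq]; exact Nat.mul_le_mul_right _ hKn
    omega
  · intro S h2 hSm
    rw [Finset.filter_image]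
    have := Finset.card_image_le (s := J.filter fun i => tripleEdge w i ⊆ S) (f := tripleEdge w)
    have := hsparse S h2 hSm
    omega

/-! ### Weighted triple counts in a sparse system -/

theorem sum_eq_sum_range_card_lt {ι : Type*} (s : Finset ι) (f : ι → ℕ) {n : ℕ}
    (hf : ∀ i ∈ s, f i ≤ n) :
    ∑ i ∈ s, f i = ∑ τ ∈ Finset.range n, (s.filter (fun i => τ < f i)).card := by
  simp_rw [Finset.card_filter]
  rw [Finset.sum_comm]
  refine Finset.sum_congr rfl fun i hi => ?_
  rw [← Finset.card_filter]
  have : (Finset.range n).filter (fun τ => τ < f i) = Finset.range (f i) := by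
    ext τ; have := hf i hi; simp only [Finset.mem_filter, Finset.mem_range]; omega
  rw [this, Finset.card_range]

/-- Each product is at most `w a * w b` times the least weight in `e`. Triples whose least weight
exceeds τ lie in the level set {w > τ}, so sparsity bounds their number by its size minus 2, which
counts its members other than `a` and `b`. Summing over τ gives the claim. -/
theorem sum_prod_le_of_sparse {C : Type*} [Fintype C] [DecidableEq C] (A : Finset (Finset C))
    (hA : ∀ e ∈ A, e.card = 3) (w : C → ℕ)
    (hS : ∀ S : Finset C, (∀ v ∈ S, 0 < w v) → 2 ≤ S.card →
      (A.filter (· ⊆ S)).card + 2 ≤ S.card)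
    (a b : C) (hab : a ≠ b) (hba : w b ≤ w a) (hb : ∀ v, v ≠ a → w v ≤ w b) :
    ∑ e ∈ A, ∏ v ∈ e, w v ≤ w a * w b * ∑ v ∈ Finset.univ \ {a, b}, w v := by
  have hmin : ∀ e ∈ A, ∃ t ≤ w a, (∀ v ∈ e, t ≤ w v) ∧ ∏ v ∈ e, w v ≤ w a * w b * t := by
    intro e he
    obtain ⟨u, hu, hmin⟩ := Finset.exists_min_image e w (Finset.card_pos.1 (by rw [hA e he]; omega))
    have hle : ∀ v, w v ≤ w a := fun v => by
      by_cases h : v = a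
      · rw [h]
      · exact (hb v h).trans hba
    refine ⟨w u, hle u, hmin, ?_⟩
    obtain ⟨x, y, hxy, hxy'⟩ : ∃ x y, x ≠ y ∧ e.erase u = {x, y} :=
      Finset.card_eq_two.1 (by rw [Finset.card_erase_of_mem hu, hA e he])
    rw [← Finset.mul_prod_erase e w hu, hxy', Finset.prod_pair hxy, mul_comm]
    gcongr ?_ * _
    by_cases hx : x = a
    · exact Nat.mul_le_mul (hle x) (hb y (by rw [← hx]; exact hxy.symm))
    · rw [mul_comm]; exact Nat.mul_le_mul (hle y) (hb x hx)
  choose! t ht1 ht2 ht3 using hmin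
  have hlevel : ∀ τ ∈ Finset.range (w a),
      (A.filter (fun e => τ < t e)).card ≤ ((Finset.univ \ {a, b}).filter (fun v => τ < w v)).card := by
    intro τ _
    have hsub : (A.filter (fun e => τ < t e)) ⊆
        A.filter (· ⊆ Finset.univ.filter (fun v => τ < w v)) := by
      intro e he
      rw [Finset.mem_filter] at he ⊢
      refine ⟨he.1, fun v hv => ?_⟩
      simp only [Finset.mem_filter, Finset.mem_univ, true_and]
      exact he.2.trans_le (ht2 e he.1 v hv)
    -- Below `w b` the level set contains `a` and `b`, as sparsity requires; from `w b` on it is at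
    -- most {a} and contains no triple.
    by_cases hτ : τ < w b
    · have h2 : ({a, b} : Finset C) ⊆ Finset.univ.filter (fun v => τ < w v) := by
        intro v hv
        simp only [Finset.mem_insert, Finset.mem_singleton] at hv
        simp only [Finset.mem_filter, Finset.mem_univ, true_and]
        rcases hv with rfl | rfl <;> omega
      have h3 := Finset.card_le_card h2
      rw [Finset.card_pair hab] at h3
      have h4 := hS _ (fun v hv => by
        simp only [Finset.mem_filter, Finset.mem_univ, true_and] at hv; omega) h3
      have h5 : (Finset.univ \ {a, b}).filter (fun v => τ < w v) =
          Finset.univ.filter (fun v => τ < w v) \ {a, b} := by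
        ext v; simp only [Finset.mem_filter, Finset.mem_sdiff, Finset.mem_univ, true_and]; tauto
      rw [h5, Finset.card_sdiff_of_subset h2, Finset.card_pair hab]
      have := Finset.card_le_card hsub
      omega
    · have h0 : A.filter (fun e => τ < t e) = ∅ := by
        refine Finset.filter_eq_empty_iff.2 fun e he hlt => ?_
        have h1 : e ⊆ {a} := fun v hv => by
          by_contra hva
          have := ht2 e he v hv
          have := hb v (by simpa using hva)
          omega
        have := Finset.card_le_card h1
        rw [hA e he, Finset.card_singleton] at this
        omega
      simp [h0]
  have key : ∑ e ∈ A, t e ≤ ∑ v ∈ Finset.univ \ {a, b}, w v := by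
    rw [sum_eq_sum_range_card_lt A t ht1,
      sum_eq_sum_range_card_lt (Finset.univ \ {a, b}) w (n := w a)]
    · exact Finset.sum_le_sum hlevel
    · intro v hv
      refine (hb v ?_).trans hba
      rintro rfl
      simp at hv
  calc ∑ e ∈ A, ∏ v ∈ e, w v ≤ ∑ e ∈ A, w a * w b * t e := Finset.sum_le_sum ht3
    _ = w a * w b * ∑ e ∈ A, t e := by rw [Finset.mul_sum]
    _ ≤ _ := Nat.mul_le_mul_left _ key

theorem exists_two_largest {C : Type*} [Fintype C] [DecidableEq C] (h : 2 ≤ Fintype.card C)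
    (w : C → ℕ) : ∃ a b, a ≠ b ∧ w b ≤ w a ∧ ∀ v, v ≠ a → w v ≤ w b := by
  have h1 : (Finset.univ : Finset C).Nonempty := Finset.card_pos.1 (by rw [Finset.card_univ]; omega)
  obtain ⟨a, -, ha⟩ := Finset.exists_max_image Finset.univ w h1
  obtain ⟨b, hb, hb'⟩ := Finset.exists_max_image (Finset.univ.erase a) w
    (Finset.card_pos.1 (by
      rw [Finset.card_erase_of_mem (Finset.mem_univ a), Finset.card_univ]; omega))
  exact ⟨a, b, (Finset.ne_of_mem_erase hb).symm, ha b (Finset.mem_univ b),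
    fun v hv => hb' v (Finset.mem_erase.2 ⟨hv, Finset.mem_univ v⟩)⟩

theorem sum_sq_add_two_mul_sum_pairs {C : Type*} [DecidableEq C] (s : Finset C) (w : C → ℕ) :
    (∑ v ∈ s, w v) ^ 2 = ∑ v ∈ s, w v ^ 2 + 2 * ∑ e ∈ s.powersetCard 2, ∏ v ∈ e, w v := by
  induction s using Finset.induction_on with
  | empty => simp
  | insert a s ha ih =>
    rw [Finset.sum_insert ha, Finset.sum_insert ha, Finset.powersetCard_succ_insert ha,
      Finset.sum_union, Finset.sum_image, Finset.powersetCard_one, Finset.sum_map, add_sq, ih]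
    · have : ∀ x ∈ s, ∏ v ∈ insert a ({x} : Finset C), w v = w a * w x := fun x hx => by
        rw [Finset.prod_pair]; rintro rfl; exact ha hx
      simp only [Function.Embedding.coeFn_mk]
      rw [Finset.sum_congr rfl this, ← Finset.mul_sum]
      ring
    · intro x hx y hy hxy
      have hx' : a ∉ x := fun h => ha ((Finset.mem_powersetCard.1 hx).1 h)
      have hy' : a ∉ y := fun h => ha ((Finset.mem_powersetCard.1 hy).1 h)
      rw [← Finset.erase_insert hx', ← Finset.erase_insert hy', hxy]
    · rw [Finset.disjoint_left]
      intro x hx hx'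
      obtain ⟨y, _, rfl⟩ := Finset.mem_image.1 hx'
      exact ha ((Finset.mem_powersetCard.1 hx).1 (Finset.mem_insert_self a y))

/-! ### Polynomial inequalities -/

/-- Equality holds at x = y = 2z, so every product offered to `nlinarith` vanishes there, through x
- 2z or through d. -/
theorem pattern_le_of_le {x y z : ℝ} (hx : 0 ≤ x) (hz : 0 ≤ z) (hxy : x ≤ y) :
    y * x ^ 2 / 2 + x * y * z + y ^ 2 * z / 2 ≤ 2 / 25 * (x + y + z) ^ 3 := by
  obtain ⟨d, rfl⟩ : ∃ d, y = x + d := ⟨y - x, by ring⟩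
  have hd : 0 ≤ d := by linarith
  nlinarith [mul_nonneg hx (sq_nonneg (x - 2 * z)), mul_nonneg hz (sq_nonneg (x - 2 * z)),
    mul_nonneg hd (sq_nonneg (x - 2 * z)), mul_nonneg hx (sq_nonneg (x - 2 * z + d)),
    mul_nonneg hz (sq_nonneg (x - 2 * z + d)), mul_nonneg hd (sq_nonneg (x - 2 * z + d)),
    mul_nonneg hx (sq_nonneg d), mul_nonneg hz (sq_nonneg d), mul_nonneg hd (sq_nonneg d),
    mul_nonneg hd (mul_nonneg hx hz), mul_nonneg hd (sq_nonneg z), mul_nonneg hd (sq_nonneg (d - z))]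

/-- The slack (x-y)³/27 is the maximum over a ≥ 0 of a²(x-y-2a), the net gain from two clusters of
size a. -/
theorem pattern_le_of_ge {x y z : ℝ} (hy : 0 ≤ y) (hz : 0 ≤ z) (hxy : y ≤ x) :
    y * x ^ 2 / 2 + x * y * z + y ^ 2 * z / 2 + (x - y) ^ 3 / 27 ≤ 2 / 25 * (x + y + z) ^ 3 := by
  obtain ⟨d, rfl⟩ : ∃ d, x = y + d := ⟨x - y, by ring⟩
  have hd : 0 ≤ d := by linarith
  nlinarith [mul_nonneg hy (sq_nonneg (y - 2 * z)), mul_nonneg hz (sq_nonneg (y - 2 * z)),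
    mul_nonneg hd (sq_nonneg (y - 2 * z)), mul_nonneg hy (sq_nonneg (y - 2 * z - d)),
    mul_nonneg hz (sq_nonneg (y - 2 * z - d)), mul_nonneg hd (sq_nonneg (y - 2 * z - d)),
    mul_nonneg hd (sq_nonneg (y - d)), mul_nonneg hd (sq_nonneg (y - 2 * d)),
    mul_nonneg hy (sq_nonneg d), mul_nonneg hz (sq_nonneg d), mul_nonneg hd (sq_nonneg d),
    mul_nonneg hd (mul_nonneg hy hz), mul_nonneg hd (sq_nonneg z), mul_nonneg hd (sq_nonneg (d - z))]

/-- Replacing p and q by their mean a can only increase the left side; the perturbation then amounts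
to a²(x-y-2a). -/
theorem perturbed_pattern_le {x y z p q : ℝ} (hx : 0 ≤ x) (hy : 0 ≤ y) (hz : 0 ≤ z)
    (hp : 0 ≤ p) (hq : 0 ≤ q) (hpq : p + q ≤ x) :
    y * (x ^ 2 - p ^ 2 - q ^ 2) / 2 + x * y * z + y ^ 2 * z / 2 + p * q * (x - p - q) ≤
      2 / 25 * (x + y + z) ^ 3 := by
  obtain ⟨a, ha⟩ : ∃ a, p + q = 2 * a := ⟨(p + q) / 2, by ring⟩
  have ha0 : 0 ≤ a := by linarith
  have h1 : p * q * (x - p - q) ≤ a ^ 2 * (x - 2 * a) := by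
    have : p * q ≤ a ^ 2 := by nlinarith [sq_nonneg (p - q)]
    have h := mul_le_mul_of_nonneg_right this (by linarith : 0 ≤ x - p - q)
    calc _ ≤ _ := h
      _ = _ := by rw [← ha]; ring
  have h2 : y * (x ^ 2 - p ^ 2 - q ^ 2) / 2 ≤ y * x ^ 2 / 2 - y * a ^ 2 := by
    have : 2 * a ^ 2 ≤ p ^ 2 + q ^ 2 := by nlinarith [sq_nonneg (p - q)]
    nlinarith [mul_le_mul_of_nonneg_left this hy]
  rcases le_total x y with h | h
  · have := pattern_le_of_le hx hz h
    have : a ^ 2 * (x - 2 * a - y) ≤ 0 :=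
      mul_nonpos_of_nonneg_of_nonpos (sq_nonneg a) (by linarith)
    linarith
  · have := pattern_le_of_ge hy hz h
    have : 0 ≤ (x - y - 3 * a) ^ 2 * (x - y + 6 * a) := mul_nonneg (sq_nonneg _) (by linarith)
    linarith

theorem cube_mul_prod_le {k : ℕ} (s : ℝ) (hs : 0 ≤ s) (w : Fin k → ℝ) (hw : ∀ i, 0 ≤ w i) :
    s ^ 3 * ∏ i, w i ≤ 27 * ((s + ∑ i, w i) / (k + 3)) ^ (k + 3) := by
  have hamgm : ∀ (n : ℕ) (z : Fin n → ℝ), (∀ i, 0 ≤ z i) → 0 < n →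
      ∏ i, z i ≤ ((∑ i, z i) / n) ^ n := by
    intro n z hz hn
    have hn' : (n : ℝ) ≠ 0 := by positivity
    have h := Real.geom_mean_le_arith_mean_weighted Finset.univ (fun _ => (n : ℝ)⁻¹) z
      (fun _ _ => by positivity) (by simp [hn']) (fun i _ => hz i)
    have h0 : 0 ≤ ∏ i, z i := Finset.prod_nonneg fun i _ => hz i
    rw [Real.finsetProd_rpow _ _ fun i _ => hz i, ← Finset.mul_sum] at h
    calc ∏ i, z i = ((∏ i, z i) ^ (n : ℝ)⁻¹) ^ n :=
          (Real.rpow_inv_natCast_pow h0 hn.ne').symm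
      _ ≤ ((n : ℝ)⁻¹ * ∑ i, z i) ^ n := pow_le_pow_left₀ (by positivity) h n
      _ = _ := by rw [inv_mul_eq_div]
  have h := hamgm (k + 3) (Fin.cons (s / 3) (Fin.cons (s / 3) (Fin.cons (s / 3) w))) (by
    intro i
    refine Fin.cases (by rw [Fin.cons_zero]; positivity) (fun i => ?_) i
    rw [Fin.cons_succ]
    refine Fin.cases (by rw [Fin.cons_zero]; positivity) (fun i => ?_) i
    rw [Fin.cons_succ]
    refine Fin.cases (by rw [Fin.cons_zero]; positivity) (fun i => ?_) i
    rw [Fin.cons_succ]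
    exact hw i) (by omega)
  simp only [Fin.prod_univ_succ, Fin.sum_univ_succ, Fin.cons_zero, Fin.cons_succ] at h
  have e1 : s / 3 + (s / 3 + (s / 3 + ∑ i, w i)) = s + ∑ i, w i := by ring
  rw [e1] at h
  push_cast at h
  linarith

/-- The subsets of `M` that project injectively along `Prod.fst` onto a member of `A`. -/
def transversals {C β : Type*} [DecidableEq C] (A : Finset (Finset C)) (M : Finset (C × β)) :
    Finset (Finset (C × β)) :=
  M.powerset.filter fun f => f.image Prod.fst ∈ A ∧ (f.image Prod.fst).card = f.card

/-- The number of elements of `M` in the cluster `v`. -/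
def clusterCard {C β : Type*} [DecidableEq C] (M : Finset (C × β)) (v : C) : ℕ :=
  (M.filter fun x => x.1 = v).card

theorem sum_clusterCard {C β : Type*} [Fintype C] [DecidableEq C] (M : Finset (C × β)) :
    ∑ v, clusterCard M v = M.card :=
  (Finset.card_eq_sum_card_fiberwise fun _ _ => Finset.mem_coe.2 (Finset.mem_univ _)).symm

theorem clusterCard_univ {C β : Type*} [Fintype C] [Fintype β] [DecidableEq C] (v : C) :
    clusterCard (Finset.univ : Finset (C × β)) v = Fintype.card β := by
  have : (Finset.univ.filter fun x : C × β => x.1 = v) = {v} ×ˢ Finset.univ := by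
    ext ⟨c, b⟩; simp [eq_comm]
  rw [clusterCard, this]
  simp

theorem card_transversals_singleton {C β : Type*} [DecidableEq C] [DecidableEq β]
    (M : Finset (C × β)) (e : Finset C) :
    (transversals {e} M).card = ∏ v ∈ e, clusterCard M v := by
  simp only [clusterCard]
  rw [← Finset.card_pi]
  symm
  refine Finset.card_bij (fun g _ => e.attach.image fun v => g v.1 v.2) ?_ ?_ ?_
  · intro g hg
    have hg' : ∀ v (hv : v ∈ e), g v hv ∈ M ∧ (g v hv).1 = v := fun v hv =>
      Finset.mem_filter.1 (Finset.mem_pi.1 hg v hv)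
    have him : (e.attach.image fun v => g v.1 v.2).image Prod.fst = e := by
      ext v
      simp only [Finset.mem_image, Finset.mem_attach, true_and, Subtype.exists]
      constructor
      · rintro ⟨x, ⟨u, hu, rfl⟩, rfl⟩
        rw [(hg' u hu).2]; exact hu
      · intro hv
        exact ⟨_, ⟨v, hv, rfl⟩, (hg' v hv).2⟩
    simp only [transversals, Finset.mem_filter, Finset.mem_powerset, Finset.mem_singleton]
    refine ⟨?_, him, ?_⟩
    · intro x hx
      obtain ⟨v, _, rfl⟩ := Finset.mem_image.1 hx
      exact (hg' _ _).1
    · refine le_antisymm Finset.card_image_le ?_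
      rw [him]
      exact Finset.card_image_le.trans_eq Finset.card_attach
  · intro g hg g' hg' h
    have hg1 : ∀ v (hv : v ∈ e), (g v hv).1 = v := fun v hv =>
      (Finset.mem_filter.1 (Finset.mem_pi.1 hg v hv)).2
    have hg1' : ∀ v (hv : v ∈ e), (g' v hv).1 = v := fun v hv =>
      (Finset.mem_filter.1 (Finset.mem_pi.1 hg' v hv)).2
    funext v hv
    have h1 : g v hv ∈ e.attach.image fun v => g' v.1 v.2 := by
      rw [← h]; exact Finset.mem_image.2 ⟨⟨v, hv⟩, Finset.mem_attach _ _, rfl⟩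
    obtain ⟨⟨u, hu⟩, _, hu'⟩ := Finset.mem_image.1 h1
    have : u = v := by rw [← hg1' u hu, ← hg1 v hv]; exact congrArg Prod.fst hu'
    subst this
    exact hu'.symm
  · intro f hf
    simp only [transversals, Finset.mem_filter, Finset.mem_powerset, Finset.mem_singleton] at hf
    obtain ⟨hfM, him, hcard⟩ := hf
    have hinj : Set.InjOn Prod.fst (f : Set (C × β)) := Finset.card_image_iff.1 hcard
    have hex : ∀ v ∈ e, ∃ x, x ∈ f ∧ x.1 = v := fun v hv => by
      rw [← him] at hv; simpa only [Finset.mem_image] using hv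
    choose g hg1 hg2 using hex
    refine ⟨g, Finset.mem_pi.2 fun v hv =>
      Finset.mem_filter.2 ⟨hfM (hg1 v hv), hg2 v hv⟩, ?_⟩
    ext x
    simp only [Finset.mem_image, Finset.mem_attach, true_and, Subtype.exists]
    constructor
    · rintro ⟨v, hv, rfl⟩
      exact hg1 v hv
    · intro hx
      have hxe : x.1 ∈ e := by rw [← him]; exact Finset.mem_image_of_mem _ hx
      exact ⟨x.1, hxe, hinj (hg1 _ hxe) hx (hg2 _ hxe)⟩

theorem card_transversals {C β : Type*} [DecidableEq C] [DecidableEq β]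
    (A : Finset (Finset C)) (M : Finset (C × β)) :
    (transversals A M).card = ∑ e ∈ A, ∏ v ∈ e, clusterCard M v := by
  have h : transversals A M = A.biUnion fun e => transversals {e} M := by
    ext f
    simp only [transversals, Finset.mem_filter, Finset.mem_biUnion, Finset.mem_singleton]
    constructor
    · rintro ⟨h1, h2, h3⟩
      exact ⟨_, h2, h1, rfl, h3⟩
    · rintro ⟨e, he, h1, rfl, h3⟩
      exact ⟨h1, he, h3⟩
  rw [h, Finset.card_biUnion]
  · exact Finset.sum_congr rfl fun e _ => card_transversals_singleton M e
  · intro e _ e' _ hne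
    rw [Function.onFun, Finset.disjoint_left]
    intro f hf hf'
    simp only [transversals, Finset.mem_filter, Finset.mem_singleton] at hf hf'
    exact hne (hf.2.1.symm.trans hf'.2.1)

theorem card_of_mem_transversals {C β : Type*} [DecidableEq C] {A : Finset (Finset C)}
    {M : Finset (C × β)} {s : ℕ} (hA : ∀ e ∈ A, e.card = s) {f : Finset (C × β)}
    (hf : f ∈ transversals A M) : f.card = s := by
  obtain ⟨-, h1, h2⟩ := Finset.mem_filter.1 hf
  rw [← h2, hA _ h1]

theorem mem_transversals_iff_univ {C β : Type*} [Fintype C] [Fintype β] [DecidableEq C]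
    {A : Finset (Finset C)} {M f : Finset (C × β)} :
    f ∈ transversals A M ↔ f ∈ transversals A Finset.univ ∧ f ⊆ M := by
  simp only [transversals, Finset.mem_filter, Finset.mem_powerset, Finset.subset_univ, true_and]
  tauto

theorem mem_powersetCard_iff_univ {α : Type*} [Fintype α] (M : Finset α) {s : Finset α} {j : ℕ} :
    s ∈ M.powersetCard j ↔ s ∈ Finset.univ.powersetCard j ∧ s ⊆ M := by
  simp only [Finset.mem_powersetCard, Finset.subset_univ, true_and, and_comm]

/-- The triples inside `M₁ ∪ M₂ ∪ M₃`, split into their three parts, given by the pattern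
`{112, 123, 223}` together with the transversals of `A` in the first part. -/
def patternTriples {C β B₂ B₃ : Type*} [Fintype C] [DecidableEq C] [DecidableEq β]
    [DecidableEq B₂] [DecidableEq B₃] (A : Finset (Finset C))
    (M₁ : Finset (C × β)) (M₂ : Finset B₂) (M₃ : Finset B₃) :
    Finset (Finset (C × β) × Finset B₂ × Finset B₃) :=
  (transversals (Finset.univ.powersetCard 2) M₁ ×ˢ M₂.powersetCard 1 ×ˢ M₃.powersetCard 0) ∪
    ((M₁.powersetCard 1 ×ˢ M₂.powersetCard 1 ×ˢ M₃.powersetCard 1) ∪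
      ((M₁.powersetCard 0 ×ˢ M₂.powersetCard 2 ×ˢ M₃.powersetCard 1) ∪
        (transversals A M₁ ×ˢ M₂.powersetCard 0 ×ˢ M₃.powersetCard 0)))

section

variable {C β B₂ B₃ : Type*} [Fintype C] [DecidableEq C] [DecidableEq β]
    [DecidableEq B₂] [DecidableEq B₃] {A : Finset (Finset C)}

theorem card_patternTriples (hA : ∀ e ∈ A, e.card = 3)
    (M₁ : Finset (C × β)) (M₂ : Finset B₂) (M₃ : Finset B₃) :
    (patternTriples A M₁ M₂ M₃).card =
      (∑ e ∈ (Finset.univ : Finset C).powersetCard 2, ∏ v ∈ e, clusterCard M₁ v) * M₂.card +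
        (M₁.card * M₂.card * M₃.card + (M₂.card.choose 2 * M₃.card +
          ∑ e ∈ A, ∏ v ∈ e, clusterCard M₁ v)) := by
  have h2 : ∀ f ∈ transversals (Finset.univ.powersetCard 2) M₁, f.card = 2 := fun f hf =>
    card_of_mem_transversals (fun e he => (Finset.mem_powersetCard.1 he).2) hf
  have h3 : ∀ f ∈ transversals A M₁, f.card = 3 := fun f hf => card_of_mem_transversals hA hf
  unfold patternTriples
  rw [Finset.card_union_of_disjoint, Finset.card_union_of_disjoint,
    Finset.card_union_of_disjoint]
  · simp only [Finset.card_product, Finset.card_powersetCard, card_transversals,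
      Nat.choose_one_right, Nat.choose_zero_right]
    ring
  all_goals
    rw [Finset.disjoint_left]
    rintro ⟨f, g, h⟩ hf hf'
    simp only [Finset.mem_union, Finset.mem_product, Finset.mem_powersetCard] at hf hf'
    have := h2 f
    have := h3 f
    grind

theorem card_add_card_add_card_of_mem_patternTriples (hA : ∀ e ∈ A, e.card = 3)
    {M₁ : Finset (C × β)} {M₂ : Finset B₂} {M₃ : Finset B₃}
    {t : Finset (C × β) × Finset B₂ × Finset B₃} (ht : t ∈ patternTriples A M₁ M₂ M₃) :
    t.1.card + t.2.1.card + t.2.2.card = 3 := by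
  have h2 : ∀ f ∈ transversals (Finset.univ.powersetCard 2) M₁, f.card = 2 := fun f hf =>
    card_of_mem_transversals (fun e he => (Finset.mem_powersetCard.1 he).2) hf
  have h3 : ∀ f ∈ transversals A M₁, f.card = 3 := fun f hf => card_of_mem_transversals hA hf
  simp only [patternTriples, Finset.mem_union, Finset.mem_product, Finset.mem_powersetCard] at ht
  have := h2 t.1
  have := h3 t.1
  grind

theorem mem_patternTriples_iff_univ [Fintype β] [Fintype B₂] [Fintype B₃]
    {M₁ : Finset (C × β)} {M₂ : Finset B₂} {M₃ : Finset B₃}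
    {t : Finset (C × β) × Finset B₂ × Finset B₃} :
    t ∈ patternTriples A M₁ M₂ M₃ ↔
      t ∈ patternTriples A Finset.univ Finset.univ Finset.univ ∧
        t.1 ⊆ M₁ ∧ t.2.1 ⊆ M₂ ∧ t.2.2 ⊆ M₃ := by
  have h1 := fun A' => mem_transversals_iff_univ (A := A') (M := M₁) (f := t.1)
  have hand : ∀ a s b u c v : Prop, (a ∧ s) ∧ (b ∧ u) ∧ (c ∧ v) ↔ (a ∧ b ∧ c) ∧ (s ∧ u ∧ v) := by
    tauto
  simp only [patternTriples, Finset.mem_union, Finset.mem_product]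
  rw [h1, h1, mem_powersetCard_iff_univ M₁, mem_powersetCard_iff_univ M₁,
    mem_powersetCard_iff_univ M₂, mem_powersetCard_iff_univ M₂, mem_powersetCard_iff_univ M₂,
    mem_powersetCard_iff_univ M₃, mem_powersetCard_iff_univ M₃]
  simp only [hand, ← or_and_right]

theorem card_patternTriples_le (hC : 2 ≤ Fintype.card C) (hA : ∀ e ∈ A, e.card = 3) {m : ℕ}
    (hsparse : ∀ S : Finset C, 2 ≤ S.card → S.card ≤ m → (A.filter (· ⊆ S)).card + 2 ≤ S.card)
    (M₁ : Finset (C × β)) (M₂ : Finset B₂) (M₃ : Finset B₃) (hM : M₁.card ≤ m) :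
    ((patternTriples A M₁ M₂ M₃).card : ℝ) ≤
      2 / 25 * ((M₁.card : ℝ) + M₂.card + M₃.card) ^ 3 := by
  obtain ⟨a, b, hab, hba, hb⟩ := exists_two_largest hC (clusterCard M₁)
  set w := clusterCard M₁ with hw
  have hsum : ∑ v, w v = M₁.card := sum_clusterCard M₁
  have hsp := sum_prod_le_of_sparse A hA w (fun S hS h2 => hsparse S h2 (by
    calc S.card = ∑ v ∈ S, 1 := by simp
      _ ≤ ∑ v ∈ S, w v := Finset.sum_le_sum hS
      _ ≤ ∑ v, w v := Finset.sum_le_univ_sum_of_nonneg fun _ => Nat.zero_le _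
      _ ≤ m := hsum.trans_le hM)) a b hab hba hb
  have hpairs := sum_sq_add_two_mul_sum_pairs (Finset.univ : Finset C) w
  have hsplit := Finset.sum_sdiff (f := w) (Finset.subset_univ {a, b})
  have hsq : w a ^ 2 + w b ^ 2 ≤ ∑ v, w v ^ 2 := by
    rw [← Finset.sum_pair (f := fun v => w v ^ 2) hab]
    exact Finset.sum_le_univ_sum_of_nonneg fun _ => Nat.zero_le _
  rw [Finset.sum_pair hab, hsum] at hsplit
  rw [hsum] at hpairs
  rw [card_patternTriples hA]
  set P := ∑ e ∈ (Finset.univ : Finset C).powersetCard 2, ∏ v ∈ e, w v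
  set Q := ∑ e ∈ A, ∏ v ∈ e, w v
  set R := ∑ v ∈ Finset.univ \ {a, b}, w v
  set U := ∑ v, w v ^ 2
  push_cast
  rw [Nat.cast_choose_two]
  have hsp' : (Q : ℝ) ≤ w a * w b * R := by exact_mod_cast hsp
  have hpairs' : (M₁.card : ℝ) ^ 2 = U + 2 * P := by exact_mod_cast hpairs
  have hsq' : (w a : ℝ) ^ 2 + (w b : ℝ) ^ 2 ≤ U := by exact_mod_cast hsq
  have hR : (R : ℝ) = M₁.card - w a - w b := by
    have : (R : ℝ) + (w a + w b) = M₁.card := by exact_mod_cast hsplit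
    linarith
  have hR0 : (0 : ℝ) ≤ R := Nat.cast_nonneg _
  have key := perturbed_pattern_le (x := M₁.card) (y := M₂.card) (z := M₃.card)
    (p := w a) (q := w b) (by positivity) (by positivity) (by positivity) (by positivity)
    (by positivity) (by linarith)
  have h1 : (P : ℝ) * M₂.card ≤ M₂.card * ((M₁.card : ℝ) ^ 2 - w a ^ 2 - w b ^ 2) / 2 := by
    have := mul_le_mul_of_nonneg_left
      (show 2 * (P : ℝ) ≤ (M₁.card : ℝ) ^ 2 - w a ^ 2 - w b ^ 2 by linarith)
      (Nat.cast_nonneg (α := ℝ) M₂.card)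
    linarith
  have h2 : (M₂.card : ℝ) * (M₂.card - 1) / 2 * M₃.card ≤ (M₂.card : ℝ) ^ 2 * M₃.card / 2 := by
    have : (0 : ℝ) ≤ M₂.card * M₃.card := by positivity
    linarith
  rw [hR] at hsp'
  linarith

end

section

variable {C β B₂ B₃ B₄ : Type*} [Fintype C] [Fintype β] [Fintype B₂] [Fintype B₃] [Fintype B₄]
  [DecidableEq C] [DecidableEq β] [DecidableEq B₂] [DecidableEq B₃] [DecidableEq B₄] {k : ℕ}

/-- The edges of the blow-up: a pattern triple together with one vertex from each of `k` further
parts. -/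
def blowupEdges (A : Finset (Finset C)) (β B₂ B₃ B₄ : Type*) [Fintype β] [Fintype B₂] [Fintype B₃]
    [Fintype B₄] [DecidableEq β] [DecidableEq B₂] [DecidableEq B₃] [DecidableEq B₄] (k : ℕ) :
    Finset (Finset ((C × β) ⊕ B₂ ⊕ B₃ ⊕ (Fin k × B₄))) :=
  Finset.univ.filter fun E =>
    (E.toLeft, E.toRight.toLeft, E.toRight.toRight.toLeft) ∈
        patternTriples A Finset.univ Finset.univ Finset.univ ∧
      E.toRight.toRight.toRight ∈ transversals {Finset.univ} Finset.univ

theorem card_of_mem_blowupEdges {A : Finset (Finset C)} (hA : ∀ e ∈ A, e.card = 3)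
    {E : Finset ((C × β) ⊕ B₂ ⊕ B₃ ⊕ (Fin k × B₄))} (hE : E ∈ blowupEdges A β B₂ B₃ B₄ k) :
    E.card = k + 3 := by
  obtain ⟨h1, h2⟩ := (Finset.mem_filter.1 hE).2
  have h3 := card_add_card_add_card_of_mem_patternTriples hA h1
  have h4 := card_of_mem_transversals (s := k) (fun e he => by
    rw [Finset.mem_singleton.1 he, Finset.card_univ, Fintype.card_fin]) h2
  rw [← E.card_toLeft_add_card_toRight, ← E.toRight.card_toLeft_add_card_toRight,
    ← E.toRight.toRight.card_toLeft_add_card_toRight]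
  dsimp only at h3
  omega

theorem card_blowupEdges_filter_subset (A : Finset (Finset C))
    (M : Finset ((C × β) ⊕ B₂ ⊕ B₃ ⊕ (Fin k × B₄))) :
    ((blowupEdges A β B₂ B₃ B₄ k).filter (· ⊆ M)).card =
      (patternTriples A M.toLeft M.toRight.toLeft M.toRight.toRight.toLeft).card *
        ∏ i, clusterCard M.toRight.toRight.toRight i := by
  rw [← card_transversals_singleton, ← Finset.card_product]
  refine Finset.card_nbij'
    (fun E => ((E.toLeft, E.toRight.toLeft, E.toRight.toRight.toLeft), E.toRight.toRight.toRight))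
    (fun t => t.1.1.disjSum (t.1.2.1.disjSum (t.1.2.2.disjSum t.2))) ?_ ?_ ?_ ?_
  · intro E hE
    simp only [Finset.coe_filter, Set.mem_ofPred_eq, blowupEdges, Finset.mem_filter,
      Finset.mem_univ, true_and] at hE
    obtain ⟨⟨h1, h2⟩, hM⟩ := hE
    have hr : E.toRight ⊆ M.toRight := Finset.toRight_subset_toRight hM
    have hrr := Finset.toRight_subset_toRight hr
    exact Finset.mem_coe.2 (Finset.mem_product.2 ⟨mem_patternTriples_iff_univ.2
      ⟨h1, Finset.toLeft_subset_toLeft hM, Finset.toLeft_subset_toLeft hr,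
        Finset.toLeft_subset_toLeft hrr⟩,
      mem_transversals_iff_univ.2 ⟨h2, Finset.toRight_subset_toRight hrr⟩⟩)
  · rintro ⟨⟨f, g, h⟩, u⟩ ht
    obtain ⟨h1, h2⟩ := Finset.mem_product.1 (Finset.mem_coe.1 ht)
    obtain ⟨h1, h3, h4, h5⟩ := mem_patternTriples_iff_univ.1 h1
    obtain ⟨h2, h6⟩ := mem_transversals_iff_univ.1 h2
    simp only [Finset.coe_filter, Set.mem_ofPred_eq, blowupEdges, Finset.mem_filter,
      Finset.mem_univ, true_and, Finset.toLeft_disjSum, Finset.toRight_disjSum,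
      Finset.disjSum_subset]
    exact ⟨⟨h1, h2⟩, h3, h4, h5, h6⟩
  · intro E _
    simp only [Finset.toLeft_disjSum_toRight]
  · rintro ⟨⟨f, g, h⟩, u⟩ _
    simp only [Finset.toLeft_disjSum, Finset.toRight_disjSum]

theorem card_blowupEdges_filter_subset_le (hC : 2 ≤ Fintype.card C) {A : Finset (Finset C)}
    (hA : ∀ e ∈ A, e.card = 3)
    (M : Finset ((C × β) ⊕ B₂ ⊕ B₃ ⊕ (Fin k × B₄)))
    (hsparse : ∀ S : Finset C, 2 ≤ S.card → S.card ≤ M.card →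
      (A.filter (· ⊆ S)).card + 2 ≤ S.card) :
    (((blowupEdges A β B₂ B₃ B₄ k).filter (· ⊆ M)).card : ℝ) ≤
      54 / 25 * ((M.card : ℝ) / (k + 3)) ^ (k + 3) := by
  rw [card_blowupEdges_filter_subset]
  have h1 := card_patternTriples_le hC hA hsparse M.toLeft M.toRight.toLeft
    M.toRight.toRight.toLeft M.card_toLeft_le
  have hM : (M.card : ℝ) = (M.toLeft.card + M.toRight.toLeft.card + M.toRight.toRight.toLeft.card) +
      ∑ i, (clusterCard M.toRight.toRight.toRight i : ℝ) := by
    rw [← Nat.cast_sum, sum_clusterCard, ← M.card_toLeft_add_card_toRight,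
      ← M.toRight.card_toLeft_add_card_toRight, ← M.toRight.toRight.card_toLeft_add_card_toRight]
    push_cast
    ring
  have h2 := cube_mul_prod_le (k := k)
    (M.toLeft.card + M.toRight.toLeft.card + M.toRight.toRight.toLeft.card : ℝ) (by positivity)
    (fun i => (clusterCard M.toRight.toRight.toRight i : ℝ)) (fun _ => Nat.cast_nonneg _)
  rw [← hM] at h2
  push_cast
  have h3 := mul_le_mul_of_nonneg_right h1
    (Finset.prod_nonneg fun i _ => Nat.cast_nonneg (α := ℝ) (clusterCard M.toRight.toRight.toRight i) :
      0 ≤ ∏ i, (clusterCard M.toRight.toRight.toRight i : ℝ))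
  linarith

/-- The `k + 3`-uniform graph with edge set `blowupEdges`. -/
def blowupGraph (A : Finset (Finset C)) (β B₂ B₃ B₄ : Type*) [Fintype β] [Fintype B₂] [Fintype B₃]
    [Fintype B₄] [DecidableEq β] [DecidableEq B₂] [DecidableEq B₃] [DecidableEq B₄] (k : ℕ) :
    Hypergraph ((C × β) ⊕ B₂ ⊕ B₃ ⊕ (Fin k × B₄)) where
  vertexSet := Set.univ
  edgeSet := (fun E : Finset ((C × β) ⊕ B₂ ⊕ B₃ ⊕ (Fin k × B₄)) => (E : Set _)) ''
    (blowupEdges A β B₂ B₃ B₄ k : Set (Finset ((C × β) ⊕ B₂ ⊕ B₃ ⊕ (Fin k × B₄))))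
  subset_vertexSet_of_mem_edgeSet' := fun _ _ => Set.subset_univ _

theorem isUniformGraph_blowupGraph {A : Finset (Finset C)} (hA : ∀ e ∈ A, e.card = 3) :
    IsUniformGraph (k + 3) (blowupGraph A β B₂ B₃ B₄ k) where
  finite_vertexSet := Set.toFinite _
  ncard_edge := by
    rintro _ ⟨E, hE, rfl⟩
    rw [Set.ncard_coe_finset]
    exact card_of_mem_blowupEdges hA hE

theorem ncard_edgeSet_le_of_isSubgraph_blowupGraph (hC : 2 ≤ Fintype.card C)
    {A : Finset (Finset C)} (hA : ∀ e ∈ A, e.card = 3) {m : ℕ}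
    (hsparse : ∀ S : Finset C, 2 ≤ S.card → S.card ≤ m → (A.filter (· ⊆ S)).card + 2 ≤ S.card)
    {H : Hypergraph ((C × β) ⊕ B₂ ⊕ B₃ ⊕ (Fin k × B₄))}
    (hH : IsSubgraph H (blowupGraph A β B₂ B₃ B₄ k)) (hm : H.vertexSet.ncard = m) :
    (H.edgeSet.ncard : ℝ) ≤ 54 / 25 * ((m : ℝ) / (k + 3)) ^ (k + 3) := by
  classical
  obtain ⟨M, hM⟩ := (Set.toFinite H.vertexSet).exists_finset_coe
  rw [← hM, Set.ncard_coe_finset] at hm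
  subst hm
  refine le_trans ?_ (card_blowupEdges_filter_subset_le hC hA M hsparse)
  have hsub : H.edgeSet ⊆ (((blowupEdges A β B₂ B₃ B₄ k).filter (· ⊆ M)).image
      (fun E : Finset _ => (E : Set ((C × β) ⊕ B₂ ⊕ B₃ ⊕ (Fin k × B₄)))) : Set (Set _)) := by
    intro e he
    obtain ⟨E, hE, rfl⟩ := hH.2 he
    have h1 : (E : Set ((C × β) ⊕ B₂ ⊕ B₃ ⊕ (Fin k × B₄))) ⊆ M := by
      rw [hM]; exact H.subset_vertexSet_of_mem_edgeSet' he
    rw [Finset.coe_image]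
    exact ⟨E, Finset.mem_coe.2 (Finset.mem_filter.2 ⟨hE, Finset.coe_subset.1 h1⟩), rfl⟩
  have := (Set.ncard_le_ncard hsub (Finset.finite_toSet _)).trans
    ((Set.ncard_coe_finset _).trans_le Finset.card_image_le)
  exact_mod_cast this

theorem ncard_edgeSet_blowupGraph {A : Finset (Finset C)} (hA : ∀ e ∈ A, e.card = 3) :
    ((blowupGraph A β B₂ B₃ B₄ k).edgeSet.ncard : ℝ) =
      (((Fintype.card C * Fintype.card β : ℝ) ^ 2 - Fintype.card C * Fintype.card β ^ 2) / 2 *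
          Fintype.card B₂ +
        Fintype.card C * Fintype.card β * Fintype.card B₂ * Fintype.card B₃ +
        Fintype.card B₂ * (Fintype.card B₂ - 1) / 2 * Fintype.card B₃ +
        A.card * Fintype.card β ^ 3) * Fintype.card B₄ ^ k := by
  have h1 : (blowupGraph A β B₂ B₃ B₄ k).edgeSet.ncard = (blowupEdges A β B₂ B₃ B₄ k).card := by
    rw [← Set.ncard_coe_finset]
    exact Set.ncard_image_of_injective _ Finset.coe_injective
  have h2 := card_blowupEdges_filter_subset (β := β) (B₂ := B₂) (B₃ := B₃) (B₄ := B₄) (k := k) A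
    Finset.univ
  have hpairs := sum_sq_add_two_mul_sum_pairs (Finset.univ : Finset C)
    (clusterCard (Finset.univ : Finset (C × β)))
  rw [Finset.filter_true_of_mem fun _ _ => Finset.subset_univ _, card_patternTriples hA] at h2
  simp only [Finset.toLeft_univ, Finset.toRight_univ, clusterCard_univ, Finset.card_univ,
    Finset.prod_const, Fintype.card_prod, Fintype.card_fin, Finset.sum_const, smul_eq_mul]
    at h2 hpairs
  have hQ : ∑ e ∈ A, Fintype.card β ^ e.card = A.card * Fintype.card β ^ 3 := by
    rw [Finset.sum_congr rfl fun e he => by rw [hA e he], Finset.sum_const, smul_eq_mul]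
  rw [h1, h2, hQ]
  set P := ∑ e ∈ (Finset.univ : Finset C).powersetCard 2, Fintype.card β ^ e.card
  have hP : (P : ℝ) = ((Fintype.card C * Fintype.card β : ℝ) ^ 2 -
      Fintype.card C * Fintype.card β ^ 2) / 2 := by
    have : (Fintype.card C * Fintype.card β : ℝ) ^ 2 =
      Fintype.card C * Fintype.card β ^ 2 + 2 * P := by exact_mod_cast hpairs
    linarith
  push_cast
  rw [Nat.cast_choose_two, hP]
  ring

end

theorem tendsto_pow_div_descFactorial (r : ℕ) :
    Filter.Tendsto (fun m : ℕ => (m : ℝ) ^ r / (m.descFactorial r : ℝ)) Filter.atTop (nhds 1) := by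
  induction r with
  | zero => simp
  | succ r ih =>
    have h1 : Filter.Tendsto (fun m : ℕ => (m : ℝ) / (m + (-r : ℝ))) Filter.atTop (nhds 1) :=
      tendsto_natCast_div_add_atTop (-r : ℝ)
    have h := h1.mul ih
    rw [mul_one] at h
    refine h.congr' ?_
    filter_upwards [Filter.eventually_ge_atTop r] with m hm
    rw [Nat.descFactorial_succ, Nat.cast_mul, Nat.cast_sub hm, pow_succ', mul_div_mul_comm,
      sub_eq_add_neg]

theorem factorial_le_pow_mul (k : ℕ) : 9 * ((k + 3)! : ℝ) ≤ 2 * ((k + 3 : ℕ) : ℝ) ^ (k + 3) := by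
  induction k with
  | zero => norm_num [Nat.factorial]
  | succ k ih =>
    rw [show k + 1 + 3 = (k + 3) + 1 by ring, Nat.factorial_succ, pow_succ, Nat.cast_mul]
    have h1 : ((k + 3 : ℕ) : ℝ) ^ (k + 3) ≤ ((k + 3 + 1 : ℕ) : ℝ) ^ (k + 3) :=
      pow_le_pow_left₀ (Nat.cast_nonneg _) (by exact_mod_cast Nat.le_succ _) _
    have h2 : (0 : ℝ) ≤ ((k + 3 + 1 : ℕ) : ℝ) := Nat.cast_nonneg _
    nlinarith [mul_le_mul_of_nonneg_left (ih.trans (mul_le_mul_of_nonneg_left h1 two_pos.le)) h2]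

theorem le_density_blowupGraph (k n L : ℕ) (hn : 0 < n) (hL : 9 ≤ L)
    {A : Finset (Finset (Fin 3 × Fin n))} (hA : ∀ e ∈ A, e.card = 3) (hcard : 5 * n ^ 2 ≤ A.card) :
    54 * ((k + 3)! : ℝ) / (25 * ((k + 3 : ℕ) : ℝ) ^ (k + 3)) +
        ((k + 3)! : ℝ) / ((k + 3 : ℕ) : ℝ) ^ (k + 3) * (1 / (125 * n)) ≤
      density (k + 3) (blowupGraph A (Fin (2 * L)) (Fin (6 * n * L)) (Fin (3 * n * L))
        (Fin (5 * n * L)) k) := by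
  have hL0 : (0 : ℝ) < L := by exact_mod_cast (by omega : 0 < L)
  have hn0 : (0 : ℝ) < n := by exact_mod_cast hn
  have hr0 : (0 : ℝ) < ((k + 3 : ℕ) : ℝ) := by positivity
  have hV : (blowupGraph A (Fin (2 * L)) (Fin (6 * n * L)) (Fin (3 * n * L))
        (Fin (5 * n * L)) k).vertexSet.ncard = (k + 3) * (5 * n * L) := by
    simp only [blowupGraph, Set.ncard_univ, Nat.card_eq_fintype_card, Fintype.card_sum,
      Fintype.card_prod, Fintype.card_fin]
    ring
  unfold density
  rw [hV, ncard_edgeSet_blowupGraph hA]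
  simp only [Fintype.card_prod, Fintype.card_fin]
  push_cast
  have hchoose : ((((k + 3) * (5 * n * L)).choose (k + 3) : ℕ) : ℝ) ≤
      (((k + 3 : ℕ) : ℝ) * (5 * n * L)) ^ (k + 3) / ((k + 3)! : ℝ) := by
    have := Nat.choose_le_pow_div (α := ℝ) (k + 3) ((k + 3) * (5 * n * L))
    push_cast at this ⊢
    exact this
  have hpos : (0 : ℝ) < ((((k + 3) * (5 * n * L)).choose (k + 3) : ℕ) : ℝ) := by
    have h : k + 3 ≤ (k + 3) * (5 * n * L) :=
      Nat.le_mul_of_pos_right _ (by have : 0 < L := by omega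
                                    positivity)
    exact_mod_cast Nat.choose_pos h
  rw [le_div_iff₀ hpos]
  have hT : (270 * (n * L : ℝ) ^ 3 + n ^ 2 * L ^ 3) * (5 * n * L : ℝ) ^ k ≤
      (((3 * n * (2 * L) : ℝ) ^ 2 - 3 * n * (2 * L) ^ 2) / 2 * (6 * n * L) +
        3 * n * (2 * L) * (6 * n * L) * (3 * n * L) +
        6 * n * L * (6 * n * L - 1) / 2 * (3 * n * L) + A.card * (2 * L) ^ 3) *
        (5 * n * L : ℝ) ^ k := by
    refine mul_le_mul_of_nonneg_right ?_ (by positivity)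
    have h1 : (5 * n ^ 2 : ℝ) * (2 * L) ^ 3 ≤ A.card * (2 * L) ^ 3 :=
      mul_le_mul_of_nonneg_right (by exact_mod_cast hcard) (by positivity)
    have h2 : (9 : ℝ) * (n ^ 2 * L ^ 2) ≤ L * (n ^ 2 * L ^ 2) :=
      mul_le_mul_of_nonneg_right (by exact_mod_cast hL) (by positivity)
    have h3 : (0 : ℝ) ≤ n ^ 2 * L ^ 3 := by positivity
    linarith
  refine le_trans (mul_le_mul_of_nonneg_left hchoose (by positivity)) (le_trans (le_of_eq ?_) hT)
  have hf : ((k + 3)! : ℝ) ≠ 0 := by positivity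
  have hk : (k : ℝ) + 3 ≠ 0 := by positivity
  rw [mul_pow, pow_add (5 * n * L : ℝ) k 3]
  push_cast
  field_simp
  ring

theorem density_le_of_isSubgraph_blowupGraph {C β B₂ B₃ B₄ : Type*} [Fintype C] [Fintype β]
    [Fintype B₂] [Fintype B₃] [Fintype B₄] [DecidableEq C] [DecidableEq β] [DecidableEq B₂]
    [DecidableEq B₃] [DecidableEq B₄] {k m : ℕ} (hC : 2 ≤ Fintype.card C)
    {A : Finset (Finset C)} (hA : ∀ e ∈ A, e.card = 3)
    (hsparse : ∀ S : Finset C, 2 ≤ S.card → S.card ≤ m → (A.filter (· ⊆ S)).card + 2 ≤ S.card)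
    {H : Hypergraph ((C × β) ⊕ B₂ ⊕ B₃ ⊕ (Fin k × B₄))}
    (hH : IsSubgraph H (blowupGraph A β B₂ B₃ B₄ k)) (hm : H.vertexSet.ncard = m) :
    density (k + 3) H ≤ 54 * ((k + 3)! : ℝ) / (25 * ((k + 3 : ℕ) : ℝ) ^ (k + 3)) *
      ((m : ℝ) ^ (k + 3) / (m.descFactorial (k + 3) : ℝ)) := by
  have h := ncard_edgeSet_le_of_isSubgraph_blowupGraph hC hA hsparse hH hm
  unfold density
  rw [hm]
  refine (div_le_div_of_nonneg_right h (Nat.cast_nonneg _)).trans (le_of_eq ?_)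
  rw [Nat.descFactorial_eq_factorial_mul_choose]
  have hf : ((k + 3)! : ℝ) ≠ 0 := by positivity
  push_cast
  rw [div_pow]
  rcases eq_or_ne ((m.choose (k + 3) : ℕ) : ℝ) 0 with h0 | h0
  · simp [h0]
  · field_simp

theorem not_jumpProperty (k : ℕ) :
    ¬ JumpProperty (k + 3) (54 * ((k + 3)! : ℝ) / (25 * ((k + 3 : ℕ) : ℝ) ^ (k + 3))) := by
  rintro ⟨c, hc, hjump⟩
  set α : ℝ := 54 * ((k + 3)! : ℝ) / (25 * ((k + 3 : ℕ) : ℝ) ^ (k + 3)) with hα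
  obtain ⟨m, hm, hmr⟩ : ∃ m : ℕ,
      α * ((m : ℝ) ^ (k + 3) / (m.descFactorial (k + 3) : ℝ)) < α + c ∧ k + 3 ≤ m := by
    have h := (tendsto_pow_div_descFactorial (k + 3)).const_mul α
    rw [mul_one] at h
    exact ((h.eventually_lt_const (by linarith)).and (Filter.eventually_ge_atTop (k + 3))).exists
  obtain ⟨n, hn, A, hA, hcard, hsparse⟩ := exists_locally_sparse_triples m (by omega)
  have hn0 : (0 : ℝ) < n := by exact_mod_cast hn
  obtain ⟨n₀, hn₀⟩ := hjump (((k + 3)! : ℝ) / ((k + 3 : ℕ) : ℝ) ^ (k + 3) * (1 / (125 * n)))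
    (by positivity) m hmr
  obtain ⟨H, hH, hHm, hHd⟩ := hn₀ _ (blowupGraph A (Fin (2 * (n₀ + 9))) (Fin (6 * n * (n₀ + 9)))
    (Fin (3 * n * (n₀ + 9))) (Fin (5 * n * (n₀ + 9))) k) (isUniformGraph_blowupGraph hA) (by
      simp only [blowupGraph, Set.ncard_univ, Nat.card_eq_fintype_card, Fintype.card_sum,
        Fintype.card_prod, Fintype.card_fin]
      have h1 : n₀ + 9 ≤ n * (n₀ + 9) := Nat.le_mul_of_pos_left _ hn
      calc n₀ < n * (n₀ + 9) := by omega
        _ ≤ 3 * n * (2 * (n₀ + 9)) := by linarith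
        _ ≤ _ := Nat.le_add_right _ _) (le_density_blowupGraph k n _ hn (by omega) hA hcard)
  have := density_le_of_isSubgraph_blowupGraph
    (by simp only [Fintype.card_prod, Fintype.card_fin]; omega) hA hsparse hH hHm
  linarith

end HypergraphJump

theorem corollary1p3 (r : ℕ) (hr : 3 ≤ r) :
    HypergraphJump.IsNonJump r (54 * (r ! : ℝ) / (25 * (r : ℝ) ^ r)) ∧
      54 * (r ! : ℝ) / (25 * (r : ℝ) ^ r) < 5 * (r ! : ℝ) / (2 * (r : ℝ) ^ r) := by
  obtain ⟨k, rfl⟩ : ∃ k, r = k + 3 := ⟨r - 3, by omega⟩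
  have hp : (0 : ℝ) < ((k + 3 : ℕ) : ℝ) ^ (k + 3) := by positivity
  have hf : (0 : ℝ) < ((k + 3)! : ℝ) := by positivity
  refine ⟨⟨by omega, ⟨by positivity, ?_⟩,
    fun h => HypergraphJump.not_jumpProperty k h.2.2⟩, ?_⟩
  · rw [div_lt_one (by positivity)]
    linarith [HypergraphJump.factorial_le_pow_mul k]
  · rw [div_lt_div_iff₀ (by positivity) (by positivity)]
    nlinarith [mul_pos hf hp]
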